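/- Let $\mathcal K$ be a differential field of characteristic $0$ with field of constants $\mathbb F$, let $Q\in\mathrm{Mat}_{2\times2}\mathcal K$, let $\widetilde{\mathcal K}\supseteq\mathcal K$ be a differential field extension with field of constants $\widetilde{\mathbb F}$, and let $B\in\mathrm{Mat}_{2\times2}\widetilde{\mathcal K}$ be any invertible matrix with $B'+QB=0$. Pseudodifferential operators over $\widetilde{\mathcal K}$ are the formal sums $\sum_{n\le N}a_n\partial^n$ ($N\in\mathbb Z$, $a_n\in\widetilde{\mathcal K}$), multiplied according to $\partial^m\circ f=\sum_{k\ge0}\binom mk f^{(k)}\partial^{m-k}$; they form $\widetilde{\mathcal K}((\partial^{-1}))$. (a) A matrix $R\in\mathrm{Mat}_{2\times2}\widetilde{\mathcal K}((\partial^{-1}))$ satisfies $R^2=\partial\mathbb 1_2+Q$ if and only if $R=B\,\Delta(\partial)\,B^{-1}$ for some matrix with constant coefficients $\Delta\in\mathrm{Mat}_{2\times2}\widetilde{\mathbb F}((\partial^{-1}))$ such that $\mathrm{tr}\,\Delta=0$ and $\det\Delta=-\partial$. (b) These matrices $\Delta$ are exactly the square roots of $\partial\mathbb 1_2$ in $\mathrm{Mat}_{2\times2}\widetilde{\mathcal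 K}((\partial^{-1}))$. (c) They are exactly the matrices $$\Delta=\begin{pmatrix}\alpha(\partial)&\beta(\partial)\\ \beta(\partial)^{-1}(\partial-\alpha(\partial)^2)&-\alpha(\partial)\end{pmatrix},\qquad \alpha,\beta\in\widetilde{\mathbb F}((\partial^{-1})),\ \beta\ne0.$$ (d) If every constant of $\widetilde{\mathcal K}$ lies in $\mathcal K$ (so that $\widetilde{\mathbb F}=\mathbb F$), then (a) holds with $\Delta\in\mathrm{Mat}_{2\times2}\mathbb F((\partial^{-1}))$. -/

import Mathlib

open scoped Differential

noncomputable section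

/-- The subfield of constants of a differential field: the elements with zero derivative. -/
def constantSubfield (K : Type*) [Field K] [Differential K] : Subfield K where
  carrier := {x | x′ = 0}
  zero_mem' := by simp
  one_mem' := by simp
  add_mem' := by
    intro a b ha hb
    simp only [Set.mem_ofPred_eq] at ha hb ⊢
    simp [ha, hb]
  neg_mem' := by
    intro a ha
    simp only [Set.mem_ofPred_eq] at ha ⊢
    simp [ha]
  mul_mem' := by
    intro a b ha hb
    simp only [Set.mem_ofPred_eq] at ha hb ⊢
    simp [Derivation.leibniz, ha, hb]
  inv_mem' := by
    intro a ha
    simp only [Set.mem_ofPred_eq] at ha ⊢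
    simp [Derivation.leibniz_inv, ha]

/-- The group of two-sided sequences `a : ℤ → V` that vanish for all large indices. -/
def boundedAboveSeq (V : Type*) [AddCommGroup V] : AddSubgroup (ℤ → V) where
  carrier := {a | ∃ N : ℤ, ∀ n, N < n → a n = 0}
  zero_mem' := ⟨0, fun _ _ => rfl⟩
  add_mem' := by
    rintro a b ⟨M, hM⟩ ⟨N, hN⟩
    exact ⟨max M N, fun n hn => by
      simp [hM n (lt_of_le_of_lt (le_max_left _ _) hn),
        hN n (lt_of_le_of_lt (le_max_right _ _) hn)]⟩
  neg_mem' := by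
    rintro a ⟨M, hM⟩
    exact ⟨M, fun n hn => by simp [hM n hn]⟩

/-- Scalar pseudodifferential operators `V((∂⁻¹))`: formal sums `∑_{n ≤ N} aₙ ∂ⁿ` with the
coefficients `aₙ ∈ V` written on the left of the powers of `∂`. -/
def PseudoDiffOp (V : Type*) [CommRing V] : Type _ := boundedAboveSeq V

namespace PseudoDiffOp

variable {V : Type*} [CommRing V]

instance : AddCommGroup (PseudoDiffOp V) := inferInstanceAs (AddCommGroup (boundedAboveSeq V))

/-- The coefficient of `∂ⁿ`. -/
def coeff (a : PseudoDiffOp V) (n : ℤ) : V := a.1 n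

theorem coeff_bounded (a : PseudoDiffOp V) : ∃ N : ℤ, ∀ n, N < n → a.coeff n = 0 := a.2

@[ext]
theorem ext {a b : PseudoDiffOp V} (h : ∀ n, a.coeff n = b.coeff n) : a = b :=
  Subtype.ext (funext h)

/-- The operator with the given coefficients. -/
def mk (f : ℤ → V) (hf : ∃ N : ℤ, ∀ n, N < n → f n = 0) : PseudoDiffOp V := ⟨f, hf⟩

/-- The monomial `a ∂ᵐ`. -/
def monomial (m : ℤ) (a : V) : PseudoDiffOp V :=
  mk (fun n => if n = m then a else 0) ⟨m, fun _ hn => if_neg hn.ne'⟩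

/-- Multiplication by a function, `a ∂⁰`. -/
def C (a : V) : PseudoDiffOp V := monomial 0 a

/-- The operator `∂`. -/
def del : PseudoDiffOp V := monomial 1 1

variable [Differential V]

/-- The contribution of `a_m ∂ᵐ` and of the `k`-th term in the expansion
`∂ᵐ ∘ f = ∑_{k ≥ 0} binom(m, k) f⁽ᵏ⁾ ∂^(m - k)` to the coefficient of `∂ʲ` in `a ∘ b`. -/
def mulTerm (a b : PseudoDiffOp V) (j : ℤ) (p : ℤ × ℕ) : V :=
  (Ring.choose p.1 p.2 : ℤ) • (a.coeff p.1 * (Differential.deriv)^[p.2] (b.coeff (j - p.1 + p.2)))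

theorem mulTerm_eq_zero {a b : PseudoDiffOp V} {M N : ℤ} (hM : ∀ n, M < n → a.coeff n = 0)
    (hN : ∀ n, N < n → b.coeff n = 0) {j : ℤ} {p : ℤ × ℕ} (h : M < p.1 ∨ N < j - p.1 + p.2) :
    mulTerm a b j p = 0 := by
  rcases h with h | h
  · simp [mulTerm, hM _ h]
  · simp [mulTerm, hN _ h, iterate_map_zero]

/-- Only finitely many terms contribute to each coefficient of a product. -/
theorem mulTerm_support_finite (a b : PseudoDiffOp V) (j : ℤ) :
    (Function.support (mulTerm a b j)).Finite := by
  obtain ⟨M, hM⟩ := a.coeff_bounded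
  obtain ⟨N, hN⟩ := b.coeff_bounded
  refine ((Set.finite_Icc (j - N) M).prod (Set.finite_Iic (N - j + M).toNat)).subset ?_
  intro p hp
  have h : ¬ (M < p.1 ∨ N < j - p.1 + p.2) := fun h => hp (mulTerm_eq_zero hM hN h)
  simp only [Set.mem_prod, Set.mem_Icc, Set.mem_Iic]
  omega

/-- The product of pseudodifferential operators, determined by
`∂ᵐ ∘ f = ∑_{k ≥ 0} binom(m, k) f⁽ᵏ⁾ ∂^(m - k)` for all integers `m`. The sum is finite. -/
instance : Mul (PseudoDiffOp V) where
  mul a b := mk (fun j => ∑ᶠ p : ℤ × ℕ, mulTerm a b j p) <| by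
    obtain ⟨M, hM⟩ := a.coeff_bounded
    obtain ⟨N, hN⟩ := b.coeff_bounded
    refine ⟨M + N, fun j hj => ?_⟩
    rw [← finsum_zero (α := ℤ × ℕ) (M := V)]
    refine finsum_congr fun p => mulTerm_eq_zero hM hN ?_
    omega

theorem coeff_mul (a b : PseudoDiffOp V) (j : ℤ) :
    (a * b).coeff j = ∑ᶠ p : ℤ × ℕ, mulTerm a b j p := rfl

end PseudoDiffOp

/-- The symbol `∂` in the field `F((∂⁻¹))` of pseudodifferential operators with constant
coefficients, which is the field of Laurent series over `F` in the variable `∂⁻¹`. -/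
def constDel (F : Type*) [Field F] : LaurentSeries F := HahnSeries.single (-1 : ℤ) (1 : F)

/-- For a field extension `L` of a differential field `K` with field of constants `F`, the
inclusion `F((∂⁻¹)) → L((∂⁻¹))`. The coefficient of `∂ⁿ` is that of `(∂⁻¹)⁻ⁿ`. -/
def constToPseudoDiffOp (K L : Type*) [Field K] [Differential K] [Field L] [Algebra K L]
    (f : LaurentSeries (constantSubfield K)) : PseudoDiffOp L :=
  PseudoDiffOp.mk (fun n => algebraMap K L (f.coeff (-n) : constantSubfield K))
    ⟨-f.order, fun n hn => by
      rw [HahnSeries.coeff_eq_zero_of_lt_order (by omega)]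
      simp⟩

/-- The matrix pseudodifferential operator `∂ 𝟙₂ + Q`. -/
def delAdd {L : Type*} [CommRing L] (Q : Matrix (Fin 2) (Fin 2) L) :
    Matrix (Fin 2) (Fin 2) (PseudoDiffOp L) :=
  Matrix.diagonal (fun _ => PseudoDiffOp.del) + Q.map PseudoDiffOp.C

/-- A matrix of constant-coefficient operators with trace `0` and determinant `-∂`. -/
def IsConstRoot {F : Type*} [Field F] (Δ : Matrix (Fin 2) (Fin 2) (LaurentSeries F)) : Prop :=
  Δ.trace = 0 ∧ Δ.det = -constDel F

end

/-!
Associativity of the product of pseudodifferential operators reduces to associativity of left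
multiplication by `∂`: the elements `x` with `(x y) z = x (y z)` for all `y`, `z` form a subring,
which contains the functions, `∂` (by the Leibniz rule and Pascal's identity) and `∂⁻¹` (since left
multiplication by `∂` is injective), hence all monomials. Each coefficient of a product depends on
only finitely many coefficients of its left factor, so this subring is everything.

Since `∂ f = f ∂ + f′`, an operator commutes with `∂` exactly when its coefficients are constants. A
root of `∂ 𝟙` commutes with `∂ 𝟙`, so it has constant coefficients, and `B′ + Q B = 0` says that
conjugation by `B` carries `∂ 𝟙` to `∂ 𝟙 + Q`. Over the field `F((∂⁻¹))` the Cayley-Hamilton theorem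
for `2 × 2` matrices gives the trace and determinant conditions, because `∂`, being of odd order,
is not a square.
-/

noncomputable section

section LeftNucleus

variable {R : Type*} [NonUnitalNonAssocRing R]

variable (R) in
/-- The left nucleus of a non-associative ring: the elements `x` such that
`x * y * z = x * (y * z)` for all `y` and `z`. -/
def leftNucleus : AddSubgroup R := (AddMonoidHom.associator (R := R)).ker

theorem mem_leftNucleus_iff {x : R} : x ∈ leftNucleus R ↔ ∀ y z, x * y * z = x * (y * z) := by
  simp only [leftNucleus, AddMonoidHom.mem_ker, DFunLike.ext_iff, AddMonoidHom.associator_apply,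
    AddMonoidHom.zero_apply, associator_apply, sub_eq_zero]

theorem mul_mem_leftNucleus {x x' : R} (hx : x ∈ leftNucleus R) (hx' : x' ∈ leftNucleus R) :
    x * x' ∈ leftNucleus R := by
  rw [mem_leftNucleus_iff] at *
  intro y z
  rw [hx, hx, hx', hx]

theorem mem_leftNucleus_of_rightInverse {x x' : R} (hx : x ∈ leftNucleus R)
    (hinj : Function.Injective (x * ·)) (hinv : Function.RightInverse (x' * ·) (x * ·)) :
    x' ∈ leftNucleus R := by
  rw [mem_leftNucleus_iff] at *
  intro y z
  apply hinj
  calc x * (x' * y * z) = x * (x' * y) * z := (hx _ _).symm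
    _ = y * z := congrArg (· * z) (hinv y)
    _ = x * (x' * (y * z)) := (hinv (y * z)).symm

end LeftNucleus

section Finsum

variable {M : Type*} [AddCommMonoid M]

theorem finsum_prod_nat {α : Type*} {f : α × ℕ → M} (hf : f.HasFiniteSupport) :
    ∑ᶠ p, f p = ∑ᶠ a, f (a, 0) + ∑ᶠ p : α × ℕ, f (p.1, p.2 + 1) := by
  let zero : α → α × ℕ := fun a => (a, 0)
  let succ : α × ℕ → α × ℕ := fun p => (p.1, p.2 + 1)
  have hzero : Function.Injective zero := fun a b h => congrArg Prod.fst h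
  have hsucc : Function.Injective succ := fun p q h => by
    simp only [succ, Prod.mk.injEq, add_left_inj] at h
    exact Prod.ext h.1 h.2
  have hdisj : Disjoint (Set.range zero) (Set.range succ) := by
    rw [Set.disjoint_range_iff]
    intro a p h
    exact absurd (congrArg Prod.snd h) (Nat.succ_ne_zero _).symm
  have huniv : Set.range zero ∪ Set.range succ = Set.univ := by
    refine Set.eq_univ_of_forall fun ⟨a, k⟩ => ?_
    cases k with
    | zero => exact Or.inl ⟨a, rfl⟩
    | succ k => exact Or.inr ⟨(a, k), rfl⟩
  rw [← finsum_mem_univ f, ← huniv,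
    finsum_mem_union' hdisj (hf.inter_of_right _) (hf.inter_of_right _),
    finsum_mem_range hzero, finsum_mem_range hsucc]

theorem hahnSeries_coeff_mul_eq_finsum {Γ R : Type*} [AddCommGroup Γ] [PartialOrder Γ]
    [IsOrderedAddMonoid Γ] [NonUnitalNonAssocSemiring R] (f g : HahnSeries Γ R) (n : Γ) :
    (f * g).coeff n = ∑ᶠ i, f.coeff i * g.coeff (n - i) := by
  classical
  have hinj : Set.InjOn Prod.fst
      (Finset.antidiagonal f.isPWO_support g.isPWO_support n : Set (Γ × Γ)) := by
    intro p hp q hq h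
    have hp := (Finset.mem_antidiagonal.1 (Finset.mem_coe.1 hp)).2.2
    have hq := (Finset.mem_antidiagonal.1 (Finset.mem_coe.1 hq)).2.2
    exact Prod.ext h (add_left_cancel ((hp.trans hq.symm).trans (congrArg (· + q.2) h.symm)))
  rw [HahnSeries.coeff_mul, finsum_eq_finsetSum_of_support_subset
    (s := (Finset.antidiagonal f.isPWO_support g.isPWO_support n).image Prod.fst),
    Finset.sum_image hinj]
  · refine Finset.sum_congr rfl fun p hp => ?_
    rw [← (Finset.mem_antidiagonal.1 hp).2.2, add_sub_cancel_left]
  · intro i hi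
    rw [Finset.coe_image]
    exact ⟨(i, n - i), Finset.mem_coe.2 <| Finset.mem_antidiagonal.2
      ⟨left_ne_zero_of_mul hi, right_ne_zero_of_mul hi, add_sub_cancel _ _⟩, rfl⟩

end Finsum

namespace PseudoDiffOp

section Coefficients

variable {V : Type*} [CommRing V]

@[simp] theorem coeff_zero (n : ℤ) : (0 : PseudoDiffOp V).coeff n = 0 := rfl

@[simp] theorem coeff_add (a b : PseudoDiffOp V) (n : ℤ) :
    (a + b).coeff n = a.coeff n + b.coeff n := rfl

@[simp] theorem coeff_sub (a b : PseudoDiffOp V) (n : ℤ) :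
    (a - b).coeff n = a.coeff n - b.coeff n := rfl

theorem coeff_sum {ι : Type*} (s : Finset ι) (f : ι → PseudoDiffOp V) (n : ℤ) :
    (∑ i ∈ s, f i).coeff n = ∑ i ∈ s, (f i).coeff n :=
  map_sum (AddMonoidHom.mk' (fun a : PseudoDiffOp V => a.coeff n) fun _ _ => rfl) f s

theorem coeff_monomial (m : ℤ) (a : V) (n : ℤ) :
    (monomial m a).coeff n = if n = m then a else 0 := rfl

/-- The operator `a` has order at most `N`; in particular `0` has order at most every `N`. -/
def OrderLE (a : PseudoDiffOp V) (N : ℤ) : Prop := ∀ n, N < n → a.coeff n = 0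

theorem exists_orderLE_sub_sum_monomial (a : PseudoDiffOp V) (r : ℤ) :
    ∃ s : Finset ℤ, (a - ∑ n ∈ s, monomial n (a.coeff n)).OrderLE r := by
  obtain ⟨M, hM⟩ := a.coeff_bounded
  refine ⟨Finset.Ioc r M, fun j hj => ?_⟩
  simp only [coeff_sub, coeff_sum, coeff_monomial, Finset.sum_ite_eq]
  split_ifs with hjM
  · exact sub_self _
  · rw [hM j (by simpa [hj] using hjM), sub_zero]

end Coefficients

section Product

variable {V : Type*} [CommRing V] [Differential V]

theorem OrderLE.mul {a b : PseudoDiffOp V} {M N : ℤ} (ha : a.OrderLE M) (hb : b.OrderLE N) :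
    (a * b).OrderLE (M + N) := fun j hj => by
  rw [coeff_mul]
  refine (finsum_congr fun p => mulTerm_eq_zero ha hb ?_).trans finsum_zero
  omega

protected theorem add_mul (a b c : PseudoDiffOp V) : (a + b) * c = a * c + b * c := by
  ext j
  rw [coeff_add, coeff_mul, coeff_mul, coeff_mul,
    ← finsum_add_distrib (mulTerm_support_finite a c j) (mulTerm_support_finite b c j)]
  exact finsum_congr fun p => by simp [mulTerm, add_mul]

protected theorem mul_add (a b c : PseudoDiffOp V) : a * (b + c) = a * b + a * c := by
  ext j
  rw [coeff_add, coeff_mul, coeff_mul, coeff_mul,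
    ← finsum_add_distrib (mulTerm_support_finite a b j) (mulTerm_support_finite a c j)]
  exact finsum_congr fun p => by simp [mulTerm, iterate_map_add, mul_add]

scoped instance : NonUnitalNonAssocRing (PseudoDiffOp V) where
  left_distrib := PseudoDiffOp.mul_add
  right_distrib := PseudoDiffOp.add_mul
  zero_mul a := by
    have h := PseudoDiffOp.add_mul 0 0 a
    rwa [add_zero, left_eq_add] at h
  mul_zero a := by
    have h := PseudoDiffOp.mul_add a 0 0
    rwa [add_zero, left_eq_add] at h

/-- The derivative of the coefficients of an operator, which is the commutator `[∂, a]`. -/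
def derivCoeff (a : PseudoDiffOp V) : PseudoDiffOp V :=
  mk (fun n => (a.coeff n)′) <| a.coeff_bounded.imp fun _ hN n hn => by rw [hN n hn, map_zero]

@[simp] theorem coeff_derivCoeff (a : PseudoDiffOp V) (n : ℤ) :
    (derivCoeff a).coeff n = (a.coeff n)′ := rfl

theorem derivCoeff_monomial (m : ℤ) (a : V) : derivCoeff (monomial m a) = monomial m a′ := by
  ext j
  rw [coeff_derivCoeff, coeff_monomial, coeff_monomial, apply_ite (Differential.deriv), map_zero]

theorem derivCoeff_mul (a b : PseudoDiffOp V) :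
    derivCoeff (a * b) = derivCoeff a * b + a * derivCoeff b := by
  ext j
  rw [coeff_derivCoeff, coeff_add, coeff_mul, coeff_mul, coeff_mul,
    ← finsum_add_distrib (mulTerm_support_finite _ _ _) (mulTerm_support_finite _ _ _),
    map_finsum _ (mulTerm_support_finite a b j)]
  refine finsum_congr fun p => ?_
  simp only [mulTerm, map_zsmul, Derivation.leibniz, coeff_derivCoeff, smul_eq_mul,
    ← Function.iterate_succ_apply', Function.iterate_succ_apply]
  rw [← smul_add, add_comm, mul_comm (Differential.deriv^[p.2] _)]

theorem coeff_monomial_natCast_mul (n : ℕ) (a : V) (y : PseudoDiffOp V) (j : ℤ) :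
    (monomial n a * y).coeff j = ∑ k ∈ Finset.range (n + 1),
      n.choose k • (a * Differential.deriv^[k] (y.coeff (j - n + k))) := by
  classical
  rw [coeff_mul, finsum_eq_finsetSum_of_support_subset
    (s := {(n : ℤ)} ×ˢ Finset.range (n + 1)), Finset.sum_product, Finset.sum_singleton]
  · simp [mulTerm, coeff_monomial, Ring.choose_natCast]
  · rintro ⟨m, k⟩ hp
    by_contra hmk
    refine hp ?_
    by_cases hm : m = n
    · have hk : n < k := by simpa [hm, Nat.lt_succ_iff] using hmk
      simp [mulTerm, hm, Ring.choose_natCast, Nat.choose_eq_zero_of_lt hk]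
    · simp [mulTerm, coeff_monomial, hm]

theorem coeff_C_mul (a : V) (y : PseudoDiffOp V) (j : ℤ) : (C a * y).coeff j = a * y.coeff j := by
  simpa [C] using coeff_monomial_natCast_mul 0 a y j

theorem coeff_del_mul (y : PseudoDiffOp V) (j : ℤ) :
    (del * y).coeff j = y.coeff (j - 1) + (y.coeff j)′ := by
  simpa [del, Finset.sum_range_succ] using coeff_monomial_natCast_mul 1 1 y j

theorem coeff_mul_of_derivCoeff_eq_zero (x : PseudoDiffOp V) {y : PseudoDiffOp V}
    (hy : derivCoeff y = 0) (j : ℤ) :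
    (x * y).coeff j = ∑ᶠ m, x.coeff m * y.coeff (j - m) := by
  have hsucc : ∀ p : ℤ × ℕ, mulTerm x y j (p.1, p.2 + 1) = 0 := fun p => by
    rw [mulTerm, Function.iterate_succ_apply, ← coeff_derivCoeff, hy, coeff_zero,
      iterate_map_zero, mul_zero, smul_zero]
  rw [coeff_mul, finsum_prod_nat (mulTerm_support_finite x y j), finsum_congr hsucc, finsum_zero,
    add_zero]
  simp [mulTerm]

theorem coeff_mul_monomial_one (x : PseudoDiffOp V) (n j : ℤ) :
    (x * monomial n 1).coeff j = x.coeff (j - n) := by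
  have hconst : derivCoeff (monomial n (1 : V)) = 0 := by
    ext i
    simp [coeff_monomial, derivCoeff_monomial]
  rw [coeff_mul_of_derivCoeff_eq_zero x hconst, finsum_eq_single _ (j - n)]
  · simp [coeff_monomial]
  · intro m hm
    rw [coeff_monomial, if_neg (by omega), mul_zero]

theorem monomial_mul_monomial_one (m n : ℤ) (a : V) :
    monomial m a * monomial n 1 = monomial (m + n) a := by
  ext j
  simp only [coeff_mul_monomial_one, coeff_monomial, sub_eq_iff_eq_add]

theorem coeff_mul_del (x : PseudoDiffOp V) (j : ℤ) : (x * del).coeff j = x.coeff (j - 1) :=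
  coeff_mul_monomial_one x 1 j

theorem del_mul (y : PseudoDiffOp V) : del * y = y * del + derivCoeff y := by
  ext j
  rw [coeff_add, coeff_del_mul, coeff_mul_del, coeff_derivCoeff]

end Product

section Associativity

variable {V : Type*} [CommRing V] [Differential V]

theorem mulTerm_mul_del_zero (x y : PseudoDiffOp V) (j m : ℤ) :
    mulTerm (x * del) y j (m + 1, 0) = mulTerm x y (j - 1) (m, 0) := by
  simp only [mulTerm, coeff_mul_del, Ring.choose_zero_right]
  congr 4 <;> ring_nf

theorem mulTerm_mul_del_succ (x y : PseudoDiffOp V) (j m : ℤ) (k : ℕ) :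
    mulTerm (x * del) y j (m + 1, k + 1) =
      mulTerm x y (j - 1) (m, k + 1) + mulTerm x (derivCoeff y) j (m, k) := by
  have h₁ : j - (m + 1) + (k + 1 : ℕ) = j - m + k := by push_cast; ring
  have h₂ : j - 1 - m + (k + 1 : ℕ) = j - m + k := by push_cast; ring
  simp only [mulTerm, coeff_mul_del, add_sub_cancel_right, h₁, h₂, coeff_derivCoeff,
    ← Function.iterate_succ_apply, Ring.choose_succ_succ, add_smul]
  exact add_comm _ _

theorem mul_del_mul (x y : PseudoDiffOp V) :
    x * del * y = x * y * del + x * derivCoeff y := by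
  ext j
  have hfin : (fun p : ℤ × ℕ => mulTerm (x * del) y j (p.1 + 1, p.2)).HasFiniteSupport :=
    (mulTerm_support_finite (x * del) y j).preimage
      ((Equiv.addRight (1 : ℤ)).prodCongr (Equiv.refl ℕ)).injective.injOn
  have hfin' : (fun p : ℤ × ℕ => mulTerm x y (j - 1) (p.1, p.2 + 1)).HasFiniteSupport :=
    (mulTerm_support_finite x y (j - 1)).preimage fun p _ q _ h => by
      simp only [Prod.mk.injEq, add_left_inj] at h
      exact Prod.ext h.1 h.2
  calc (x * del * y).coeff j
      = ∑ᶠ p : ℤ × ℕ, mulTerm (x * del) y j (p.1 + 1, p.2) :=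
        (finsum_comp_equiv ((Equiv.addRight (1 : ℤ)).prodCongr (Equiv.refl ℕ))).symm
    _ = ∑ᶠ m, mulTerm x y (j - 1) (m, 0) + (∑ᶠ p : ℤ × ℕ, mulTerm x y (j - 1) (p.1, p.2 + 1) +
          ∑ᶠ p : ℤ × ℕ, mulTerm x (derivCoeff y) j p) := by
        rw [finsum_prod_nat hfin, ← finsum_add_distrib hfin' (mulTerm_support_finite _ _ _)]
        simp only [mulTerm_mul_del_zero, mulTerm_mul_del_succ]
    _ = (x * y * del + x * derivCoeff y).coeff j := by
        rw [← add_assoc, ← finsum_prod_nat (mulTerm_support_finite x y (j - 1)), coeff_add,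
          coeff_mul_del, coeff_mul, coeff_mul]

theorem C_mem_leftNucleus (a : V) : C a ∈ leftNucleus (PseudoDiffOp V) := by
  refine mem_leftNucleus_iff.2 fun y z => ?_
  ext j
  rw [coeff_C_mul, coeff_mul, coeff_mul, ← smul_eq_mul a, smul_finsum' _
    (mulTerm_support_finite y z j)]
  refine finsum_congr fun p => ?_
  rw [mulTerm, mulTerm, coeff_C_mul, smul_comm a, smul_eq_mul, mul_assoc]

theorem del_mem_leftNucleus : del ∈ leftNucleus (PseudoDiffOp V) :=
  mem_leftNucleus_iff.2 fun y z => by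
    rw [del_mul, add_mul, mul_del_mul, del_mul, derivCoeff_mul]
    abel

theorem del_mul_injective : Function.Injective (del * · : PseudoDiffOp V → PseudoDiffOp V) := by
  refine (injective_iff_map_eq_zero (AddMonoidHom.mulLeft del)).2 fun y hy => ?_
  have hrec (n : ℤ) : y.coeff (n - 1) + (y.coeff n)′ = 0 := by
    rw [← coeff_del_mul]
    exact congrArg (·.coeff n) hy
  obtain ⟨N, hN⟩ := y.coeff_bounded
  ext n
  rcases le_or_gt n (N + 1) with hn | hn
  · induction n, hn using Int.leInductionDown with
    | base => exact hN _ (lt_add_one N)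
    | pred n _ ih => simpa [ih] using hrec n
  · exact hN n (by omega)

theorem monomial_neg_one_mem_leftNucleus : monomial (-1) 1 ∈ leftNucleus (PseudoDiffOp V) := by
  refine mem_leftNucleus_of_rightInverse del_mem_leftNucleus del_mul_injective fun y => ?_
  have hdel : (del * monomial (-1) 1 : PseudoDiffOp V) = C 1 := monomial_mul_monomial_one 1 (-1) 1
  dsimp only
  rw [← mem_leftNucleus_iff.1 del_mem_leftNucleus, hdel]
  ext j
  rw [coeff_C_mul, one_mul]

theorem monomial_mem_leftNucleus (m : ℤ) (a : V) :
    monomial m a ∈ leftNucleus (PseudoDiffOp V) := by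
  induction m using Int.induction_on with
  | zero => exact C_mem_leftNucleus a
  | succ m ih =>
    rw [← monomial_mul_monomial_one]
    exact mul_mem_leftNucleus ih del_mem_leftNucleus
  | pred m ih =>
    rw [sub_eq_add_neg, ← monomial_mul_monomial_one]
    exact mul_mem_leftNucleus ih monomial_neg_one_mem_leftNucleus

protected theorem mul_assoc (a b c : PseudoDiffOp V) : a * b * c = a * (b * c) := by
  ext j
  obtain ⟨N, hb⟩ : ∃ N, b.OrderLE N := b.coeff_bounded
  obtain ⟨P, hc⟩ : ∃ P, c.OrderLE P := c.coeff_bounded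
  obtain ⟨s, hr⟩ := exists_orderLE_sub_sum_monomial a (j - N - P - 1)
  set a' := ∑ n ∈ s, monomial n (a.coeff n)
  have ha' : a' ∈ leftNucleus (PseudoDiffOp V) :=
    sum_mem fun n _ => monomial_mem_leftNucleus n (a.coeff n)
  have hassoc : a * b * c - a * (b * c) = (a - a') * b * c - (a - a') * (b * c) := by
    simp only [sub_mul, mem_leftNucleus_iff.1 ha' b c]
    abel
  rw [← sub_eq_zero, ← coeff_sub, hassoc, coeff_sub, (hr.mul hb).mul hc j (by omega),
    hr.mul (hb.mul hc) j (by omega), sub_zero]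

scoped instance : Ring (PseudoDiffOp V) where
  __ : NonUnitalNonAssocRing (PseudoDiffOp V) := inferInstance
  mul_assoc := PseudoDiffOp.mul_assoc
  one := C 1
  one_mul a := by
    ext j
    exact (coeff_C_mul 1 a j).trans (one_mul _)
  mul_one a := by
    ext j
    exact (coeff_mul_monomial_one a 0 j).trans (by rw [sub_zero])

end Associativity

section Commutation

variable {V : Type*} [CommRing V] [Differential V]

theorem commute_del_iff {y : PseudoDiffOp V} : Commute del y ↔ derivCoeff y = 0 := by
  rw [commute_iff_eq, del_mul, add_eq_left]

theorem del_mul_C (a : V) : del * C a = C a * del + C a′ := by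
  rw [del_mul, C, C, derivCoeff_monomial]

variable (V) in
/-- The embedding `C` of the functions as the operators of order zero. -/
def cHom : V →+* PseudoDiffOp V where
  toFun := C
  map_one' := rfl
  map_mul' a b := by
    ext j
    rw [coeff_C_mul, C, C, coeff_monomial, coeff_monomial, mul_ite, mul_zero]
  map_zero' := by
    ext j
    exact ite_self 0
  map_add' a b := by
    ext j
    simp only [coeff_add, C, coeff_monomial, ← ite_add_zero]

end Commutation

end PseudoDiffOp

open PseudoDiffOp

section ConstantCoefficients

variable (K L : Type*) [Field K] [Differential K] [Field L] [Algebra K L]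

theorem coeff_constToPseudoDiffOp (f : LaurentSeries (constantSubfield K)) (n : ℤ) :
    (constToPseudoDiffOp K L f).coeff n =
      algebraMap K L (f.coeff (-n) : constantSubfield K) := rfl

theorem constToPseudoDiffOp_single (n : ℤ) (a : constantSubfield K) :
    constToPseudoDiffOp K L (HahnSeries.single n a) = monomial (-n) (algebraMap K L a) := by
  ext j
  rw [coeff_constToPseudoDiffOp, coeff_monomial, HahnSeries.coeff_single]
  split_ifs <;> first | omega | simp

theorem constToPseudoDiffOp_injective : Function.Injective (constToPseudoDiffOp K L) :=
  fun f g h => by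
    ext n
    simpa [coeff_constToPseudoDiffOp] using congrArg (·.coeff (-n)) h

variable [Differential L] [DifferentialAlgebra K L]

theorem derivCoeff_constToPseudoDiffOp (f : LaurentSeries (constantSubfield K)) :
    derivCoeff (constToPseudoDiffOp K L f) = 0 := by
  ext n
  rw [coeff_derivCoeff, coeff_constToPseudoDiffOp, deriv_algebraMap,
    show ((f.coeff (-n) : constantSubfield K) : K)′ = 0 from (f.coeff (-n)).2, map_zero, coeff_zero]

theorem constToPseudoDiffOp_mul (f g : LaurentSeries (constantSubfield K)) :
    constToPseudoDiffOp K L (f * g) = constToPseudoDiffOp K L f * constToPseudoDiffOp K L g := by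
  let φ : constantSubfield K →+* L := (algebraMap K L).comp (constantSubfield K).subtype
  ext n
  calc φ ((f * g).coeff (-n))
      = ∑ᶠ i, φ (f.coeff i * g.coeff (-n - i)) := by
        rw [hahnSeries_coeff_mul_eq_finsum]
        exact φ.toAddMonoidHom.map_finsum_of_injective φ.injective _
    _ = ∑ᶠ m, φ (f.coeff (-m)) * φ (g.coeff (-(n - m))) := by
        rw [← finsum_comp_equiv (Equiv.neg ℤ)]
        simp only [Equiv.neg_apply, map_mul, neg_sub, sub_neg_eq_add, neg_add_eq_sub]
    _ = (constToPseudoDiffOp K L f * constToPseudoDiffOp K L g).coeff n :=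
        (coeff_mul_of_derivCoeff_eq_zero (constToPseudoDiffOp K L f)
          (derivCoeff_constToPseudoDiffOp K L g) n).symm

/-- The embedding `constToPseudoDiffOp` of the constant-coefficient operators, as a ring
homomorphism. -/
def constHom : LaurentSeries (constantSubfield K) →+* PseudoDiffOp L where
  toFun := constToPseudoDiffOp K L
  map_one' := (constToPseudoDiffOp_single K L 0 1).trans (by
    rw [neg_zero, OneMemClass.coe_one, map_one]; rfl)
  map_zero' := by
    ext n
    simp [coeff_constToPseudoDiffOp]
  map_add' f g := by
    ext n
    simp [coeff_constToPseudoDiffOp]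
  map_mul' := constToPseudoDiffOp_mul K L

theorem constHom_constDel : constHom K L (constDel (constantSubfield K)) = del :=
  (constToPseudoDiffOp_single K L (-1) 1).trans (by
    rw [neg_neg, OneMemClass.coe_one, map_one]; rfl)

theorem exists_algebraMap_constantSubfield_eq [Differential.ContainConstants K L] {x : L}
    (hx : x′ = 0) : ∃ a : constantSubfield K, algebraMap K L a = x := by
  obtain ⟨a, rfl⟩ := mem_range_of_deriv_eq_zero K hx
  rw [deriv_algebraMap, map_eq_zero] at hx
  exact ⟨⟨a, hx⟩, rfl⟩

theorem mem_range_constToPseudoDiffOp [Differential.ContainConstants K L] {y : PseudoDiffOp L}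
    (hy : derivCoeff y = 0) : y ∈ Set.range (constToPseudoDiffOp K L) := by
  have hconst (n : ℤ) : ∃ a : constantSubfield K, algebraMap K L a = y.coeff (-n) :=
    exists_algebraMap_constantSubfield_eq K L (congrArg (·.coeff (-n)) hy)
  choose f hf using hconst
  obtain ⟨N, hN⟩ := y.coeff_bounded
  have hbdd : BddBelow (Function.support f) := by
    refine ⟨-N, fun m hm => le_of_not_gt fun hlt => hm ?_⟩
    have h := hf m
    rw [hN _ (by omega), map_eq_zero] at h
    exact_mod_cast h
  refine ⟨HahnSeries.ofSuppBddBelow f hbdd, ?_⟩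
  ext n
  rw [coeff_constToPseudoDiffOp, HahnSeries.coeff_ofSuppBddBelow, hf, neg_neg]

end ConstantCoefficients

section TwoByTwo

open Matrix

theorem mul_self_eq_diagonal_iff {R : Type*} [CommRing R] [IsDomain R] {c : R}
    (hc : ¬ IsSquare c) (M : Matrix (Fin 2) (Fin 2) R) :
    M * M = diagonal (fun _ => c) ↔ M.trace = 0 ∧ M.det = -c := by
  have hCH : M * M = M.trace • M - diagonal fun _ => M.det := by
    have h := M.aeval_self_charpoly
    simp only [charpoly_fin_two, map_add, map_sub, map_mul, map_pow, Polynomial.aeval_X,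
      Polynomial.aeval_C] at h
    rw [← sq, eq_sub_iff_add_eq, ← sub_eq_zero, add_sub_right_comm, Algebra.smul_def]
    exact h
  constructor
  · intro hM
    have htrace : M.trace = 0 := by
      by_contra ht
      have h₀₁ : M 0 1 = 0 := by
        have h := congrFun₂ (hCH.symm.trans hM) 0 1
        simpa [ht] using h
      refine hc ⟨M 0 0, ?_⟩
      have h := congrFun₂ hM 0 0
      simpa [Matrix.mul_apply, h₀₁, eq_comm] using h
    have h := congrFun₂ (hCH.symm.trans hM) 0 0
    refine ⟨htrace, ?_⟩
    simpa [htrace, neg_eq_iff_eq_neg] using h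
  · rintro ⟨htrace, hdet⟩
    rw [hCH, htrace, hdet, zero_smul, zero_sub, diagonal_neg]
    simp

theorem trace_eq_zero_and_det_eq_neg_iff {F : Type*} [Field F] {c : F} (hc : ¬ IsSquare c)
    (M : Matrix (Fin 2) (Fin 2) F) :
    M.trace = 0 ∧ M.det = -c ↔ ∃ α β : F, β ≠ 0 ∧ M = !![α, β; β⁻¹ * (c - α ^ 2), -α] := by
  constructor
  · rintro ⟨htrace, hdet⟩
    rw [trace_fin_two] at htrace
    rw [det_fin_two] at hdet
    have hprod : M 0 1 * M 1 0 = c - M 0 0 ^ 2 := by linear_combination M 0 0 * htrace - hdet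
    have hβ : M 0 1 ≠ 0 := fun hβ => hc ⟨M 0 0, by linear_combination M 1 0 * hβ - hprod⟩
    refine ⟨M 0 0, M 0 1, hβ, ?_⟩
    rw [← hprod, inv_mul_cancel_left₀ hβ, ← eq_neg_of_add_eq_zero_right htrace]
    exact eta_fin_two M
  · rintro ⟨α, β, hβ, rfl⟩
    refine ⟨by simp [trace_fin_two], ?_⟩
    rw [det_fin_two_of, mul_inv_cancel_left₀ hβ]
    ring

theorem not_isSquare_constDel (F : Type*) [Field F] : ¬ IsSquare (constDel F) := by
  rintro ⟨d, hd⟩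
  have horder := congrArg HahnSeries.order hd
  rw [← sq, HahnSeries.order_pow, constDel, HahnSeries.order_single one_ne_zero,
    nsmul_eq_mul] at horder
  omega

theorem sq_eq_diagonal_constDel_iff {F : Type*} [Field F]
    (Δ : Matrix (Fin 2) (Fin 2) (LaurentSeries F)) :
    Δ ^ 2 = diagonal (fun _ => constDel F) ↔ IsConstRoot Δ := by
  rw [sq]
  exact mul_self_eq_diagonal_iff (not_isSquare_constDel F) Δ

end TwoByTwo

section Roots

open Matrix

variable {n : Type*} [Fintype n] [DecidableEq n]

theorem commute_apply_of_commute_diagonal {R : Type*} [NonUnitalNonAssocSemiring R] {r : R}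
    {M : Matrix n n R} (h : Commute (diagonal fun _ => r) M) (i j : n) : Commute r (M i j) := by
  have hij := congrFun₂ h.eq i j
  rwa [diagonal_mul, mul_diagonal] at hij

theorem pow_eq_conj_iff {M : Type*} [Monoid M] (u : Mˣ) (k : ℕ) (x d : M) :
    x ^ k = u * d * u⁻¹.val ↔ ∃ s, s ^ k = d ∧ x = u * s * u⁻¹.val := by
  constructor
  · intro hx
    have hconj : x = u * (u⁻¹.val * x * u) * u⁻¹.val := by simp [mul_assoc]
    refine ⟨u⁻¹.val * x * u, ?_, hconj⟩
    rwa [hconj, Units.conj_pow, Units.mul_left_inj, Units.mul_right_inj] at hx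
  · rintro ⟨s, rfl, rfl⟩
    exact Units.conj_pow u s k

section ConjugationByFundamentalMatrix

variable {V : Type*} [CommRing V] [Differential V]

theorem diagonal_del_add_mul_map_C (Q B : Matrix n n V) :
    (diagonal (fun _ => del) + Q.map C) * B.map C =
      B.map C * diagonal (fun _ => del) + (B.map (fun b => b′) + Q * B).map C := by
  have hdel : diagonal (fun _ : n => del) * B.map C =
      B.map C * diagonal (fun _ => del) + B.map fun b => C b′ := by
    ext1 i j
    rw [diagonal_mul, Matrix.add_apply, mul_diagonal]
    exact del_mul_C _
  have hmap : (B.map (fun b => b′) + Q * B).map C = (B.map fun b => C b′) + Q.map C * B.map C := by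
    change (cHom V).mapMatrix _ = _
    rw [map_add, map_mul]
    rfl
  rw [add_mul, hdel, hmap, add_assoc]

theorem diagonal_del_add_eq_conj {Q : Matrix n n V} {B : (Matrix n n V)ˣ}
    (h : B.val.map (fun b => b′) + Q * B.val = 0) :
    diagonal (fun _ => del) + Q.map C =
      (Units.map (cHom V).mapMatrix.toMonoidHom B).val * diagonal (fun _ => del) *
        (Units.map (cHom V).mapMatrix.toMonoidHom B)⁻¹.val := by
  refine (Units.eq_mul_inv_iff_mul_eq _).2 ((diagonal_del_add_mul_map_C Q B.val).trans ?_)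
  have hzero : (0 : Matrix n n V).map C = 0 := Matrix.map_zero _ (map_zero (cHom V))
  rw [h, hzero, add_zero]
  rfl

end ConjugationByFundamentalMatrix

variable {K L : Type*} [Field K] [Differential K] [Field L] [Differential L] [Algebra K L]
  [DifferentialAlgebra K L] [Differential.ContainConstants K L]

theorem pow_eq_diagonal_del_iff (k : ℕ) (S : Matrix n n (PseudoDiffOp L)) :
    S ^ k = diagonal (fun _ => del) ↔
      ∃ Δ : Matrix n n (LaurentSeries (constantSubfield K)),
        Δ ^ k = diagonal (fun _ => constDel _) ∧ S = Δ.map (constToPseudoDiffOp K L) := by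
  have hpow (Δ : Matrix n n (LaurentSeries (constantSubfield K))) :
      (Δ.map (constToPseudoDiffOp K L)) ^ k = diagonal (fun _ => del) ↔
        Δ ^ k = diagonal (fun _ => constDel _) := by
    have hdel : (constHom K L).mapMatrix (diagonal fun _ : n => constDel _) =
        diagonal fun _ => del := by
      rw [RingHom.mapMatrix_apply, diagonal_map (map_zero _), constHom_constDel]
    change (constHom K L).mapMatrix Δ ^ k = _ ↔ _
    rw [← map_pow, ← hdel]
    exact (Matrix.map_injective (constToPseudoDiffOp_injective K L)).eq_iff
  constructor
  · intro hS
    have hcomm : Commute (diagonal fun _ => del) S := hS ▸ Commute.pow_self S k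
    have hmem (i j : n) : S i j ∈ Set.range (constToPseudoDiffOp K L) :=
      mem_range_constToPseudoDiffOp K L
        (commute_del_iff.1 (commute_apply_of_commute_diagonal hcomm i j))
    choose Δ hΔ using hmem
    obtain rfl : (of Δ).map (constToPseudoDiffOp K L) = S := Matrix.ext hΔ
    exact ⟨of Δ, (hpow _).1 hS, rfl⟩
  · rintro ⟨Δ, hΔ, rfl⟩
    exact (hpow Δ).2 hΔ

theorem pow_eq_diagonal_del_add_iff (k : ℕ) {Q B : Matrix n n L} (hB : IsUnit B)
    (hBQ : B.map (fun b => b′) + Q * B = 0) (R : Matrix n n (PseudoDiffOp L)) :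
    R ^ k = diagonal (fun _ => del) + Q.map C ↔
      ∃ Δ : Matrix n n (LaurentSeries (constantSubfield K)),
        Δ ^ k = diagonal (fun _ => constDel _) ∧
        R = B.map C * Δ.map (constToPseudoDiffOp K L) * B⁻¹.map C := by
  obtain ⟨B, rfl⟩ := hB
  rw [diagonal_del_add_eq_conj hBQ, pow_eq_conj_iff, ← coe_units_inv]
  simp only [pow_eq_diagonal_del_iff (K := K)]
  constructor
  · rintro ⟨_, ⟨Δ, hΔ, rfl⟩, rfl⟩
    exact ⟨Δ, hΔ, rfl⟩
  · rintro ⟨Δ, hΔ, rfl⟩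
    exact ⟨_, ⟨Δ, hΔ, rfl⟩, rfl⟩

end Roots

theorem propositionA3_general {K L : Type*} [Field K] [Differential K] [Field L] [Differential L]
    [Algebra K L] [DifferentialAlgebra K L] [Differential.ContainConstants K L]
    {Q B : Matrix (Fin 2) (Fin 2) L} (hB : IsUnit B)
    (hBQ : B.map (fun b => b′) + Q * B = 0) :
    (∀ R : Matrix (Fin 2) (Fin 2) (PseudoDiffOp L),
      R * R = delAdd Q ↔
        ∃ Δ : Matrix (Fin 2) (Fin 2) (LaurentSeries (constantSubfield K)),
          IsConstRoot Δ ∧ R = B.map C * Δ.map (constToPseudoDiffOp K L) * B⁻¹.map C) ∧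
    (∀ S : Matrix (Fin 2) (Fin 2) (PseudoDiffOp L),
      S * S = Matrix.diagonal (fun _ => del) ↔
        ∃ Δ : Matrix (Fin 2) (Fin 2) (LaurentSeries (constantSubfield K)),
          IsConstRoot Δ ∧ S = Δ.map (constToPseudoDiffOp K L)) ∧
    (∀ Δ : Matrix (Fin 2) (Fin 2) (LaurentSeries (constantSubfield K)),
      IsConstRoot Δ ↔
        ∃ α β : LaurentSeries (constantSubfield K), β ≠ 0 ∧
          Δ = !![α, β; β⁻¹ * (constDel (constantSubfield K) - α ^ 2), -α]) := by
  refine ⟨fun R => ?_, fun S => ?_,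
    trace_eq_zero_and_det_eq_neg_iff (not_isSquare_constDel (constantSubfield K))⟩
  · simp only [← sq_eq_diagonal_constDel_iff, ← sq]
    exact pow_eq_diagonal_del_add_iff 2 hB hBQ R
  · simp only [← sq_eq_diagonal_constDel_iff, ← sq]
    exact pow_eq_diagonal_del_iff 2 S

end

theorem propositionA3 {K L : Type*} [Field K] [CharZero K] [Differential K]
    [Field L] [Differential L] [Algebra K L] [DifferentialAlgebra K L]
    (Q : Matrix (Fin 2) (Fin 2) K) (B : Matrix (Fin 2) (Fin 2) L) (hB : IsUnit B)
    (hBQ : B.map (fun b => b′) + Q.map (algebraMap K L) * B = 0) :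
    (∀ R : Matrix (Fin 2) (Fin 2) (PseudoDiffOp L),
      R * R = delAdd (Q.map (algebraMap K L)) ↔
        ∃ Δ : Matrix (Fin 2) (Fin 2) (LaurentSeries (constantSubfield L)),
          IsConstRoot Δ ∧
          R = B.map PseudoDiffOp.C * Δ.map (constToPseudoDiffOp L L) *
            B⁻¹.map PseudoDiffOp.C) ∧
    (∀ S : Matrix (Fin 2) (Fin 2) (PseudoDiffOp L),
      S * S = Matrix.diagonal (fun _ => PseudoDiffOp.del) ↔
        ∃ Δ : Matrix (Fin 2) (Fin 2) (LaurentSeries (constantSubfield L)),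
          IsConstRoot Δ ∧ S = Δ.map (constToPseudoDiffOp L L)) ∧
    (∀ Δ : Matrix (Fin 2) (Fin 2) (LaurentSeries (constantSubfield L)),
      IsConstRoot Δ ↔
        ∃ α β : LaurentSeries (constantSubfield L), β ≠ 0 ∧
          Δ = !![α, β; β⁻¹ * (constDel (constantSubfield L) - α ^ 2), -α]) ∧
    (Differential.ContainConstants K L →
      ∀ R : Matrix (Fin 2) (Fin 2) (PseudoDiffOp L),
        R * R = delAdd (Q.map (algebraMap K L)) ↔
          ∃ Δ : Matrix (Fin 2) (Fin 2) (LaurentSeries (constantSubfield K)),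
            IsConstRoot Δ ∧
            R = B.map PseudoDiffOp.C * Δ.map (constToPseudoDiffOp K L) *
              B⁻¹.map PseudoDiffOp.C) := by
  obtain ⟨ha, hb, hc⟩ := propositionA3_general (K := L) hB hBQ
  exact ⟨ha, hb, hc, fun _ => (propositionA3_general (K := K) hB hBQ).1⟩
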